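/- \textbf{The FCMJ problem.} An instance of the Frequency-Constrained Maintenance Jobs (FCMJ) problem consists of a rooted tree whose internal nodes form a set $\mathcal M$ of modules (the root is a module) and whose leaves form a set $\mathcal C$ of components, of a setup cost $K_v\in\mathbb Z_{\ge 0}$ for every $v\in\mathcal C\cup\mathcal M$, and of a cycle limit $f_c\in\mathbb Z_{>0}$ for every $c\in\mathcal C$. For $m\in\mathcal M$ let $C_m\subseteq\mathcal C$ be the set of components that are children of $m$. The problem is to find positive integers $q_c\le f_c$ ($c\in\mathcal C$) that minimize $$\sum_{c\in\mathcal C}\frac{K_c}{q_c}+\sum_{m\in\mathcal M}K_m\sum_{\emptyset\ne C\subseteq C_m}\frac{(-1)^{|C|+1}}{\operatorname{lcm}(q_c:c\in C)} .$$ Instances and solutions are encoded with all numbers in binary. \textbf{Theorem 1.} (i) If there is a polynomial-time exact algorithm for FCMJ, that is, a Turing machine that outputs an optimal solution of any given instance in time polynomial in the encoding length of the instance, then there is a polynomial-time algorithm for integer factorization, that is, a Turing machine that outputs, for any positive integer $n$ given in binary, a list of primes with product $n$ in time polynomial in the number of binary digits of $n$, that is, in $\log n$. (ii) Let $M$ be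 a composite number, and consider the FCMJ instance with one module, numbered $0$, that contains two components, numbered $1$ and $2$, with setup costs $K_0=1$, $K_1=M^2(M-1)-1$, $K_2=0$ and cycle limits $f_1=M$, $f_2=M-2$. Then every optimal solution $(q_1,q_2)$ of this instance satisfies $q_1=M$, and $\gcd(q_2,M)$ is a divisor of $M$ with $1<\gcd(q_2,M)<M$. -/

import Mathlib

/-- An instance of the Frequency-Constrained Maintenance Jobs problem. The hierarchical system is a
rooted tree whose internal nodes are the modules (numbered by `Fin numMod`, one of them being the
root) and whose leaves are the components (numbered by `Fin numComp`). It is given by the parent of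
every module (with the convention that the root is its own parent) and of every component.
Setup costs are nonnegative integers and cycle limits are positive integers. -/
structure FCMJ where
  /-- number of modules -/
  numMod : ℕ
  /-- number of components -/
  numComp : ℕ
  /-- the root module -/
  root : Fin numMod
  /-- the module containing a given module -/
  modParent : Fin numMod → Fin numMod
  /-- the module containing a given component -/
  compParent : Fin numComp → Fin numMod
  /-- setup costs of the modules -/
  modCost : Fin numMod → ℕ
  /-- setup costs of the components -/
  compCost : Fin numComp → ℕ
  /-- cycle limits of the components -/
  limit : Fin numComp → ℕ
  /-- convention at the root -/
  modParent_root : modParent root = root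
  /-- every module is reached from the root, so the modules form an arborescence -/
  reaches_root : ∀ m, ∃ k : ℕ, modParent^[k] m = root
  /-- no module is a leaf: the leaves are exactly the components -/
  not_leaf : ∀ m, (∃ c, compParent c = m) ∨ ∃ m', m' ≠ root ∧ modParent m' = m
  /-- cycle limits are positive -/
  limit_pos : ∀ c, 0 < limit c

namespace FCMJ

/-- The set of components that are children of the module `m`. -/
def children (I : FCMJ) (m : Fin I.numMod) : Finset (Fin I.numComp) :=
  Finset.univ.filter fun c => I.compParent c = m

/-- The cost rate of a family of cycle times `q`: component `c` contributes `K_c / q_c`, module `m`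
contributes `K_m ∑ (-1)^(|C|+1) / lcm (q_c : c ∈ C)`, summed over the nonempty sets `C` of
components that are children of `m`. -/
def cost (I : FCMJ) (q : Fin I.numComp → ℕ) : ℚ :=
  (∑ c, (I.compCost c : ℚ) / (q c : ℚ)) +
    ∑ m, (I.modCost m : ℚ) *
      ∑ C ∈ (I.children m).powerset.filter (fun C => C.Nonempty),
        (-1 : ℚ) ^ (C.card + 1) / ((C.lcm q : ℕ) : ℚ)

/-- Cycle times are positive integers that respect the cycle limits. -/
def IsFeasible (I : FCMJ) (q : Fin I.numComp → ℕ) : Prop :=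
  ∀ c, 0 < q c ∧ q c ≤ I.limit c

/-- `q` is an optimal solution: it is feasible and has the least cost rate. -/
def IsOptimal (I : FCMJ) (q : Fin I.numComp → ℕ) : Prop :=
  I.IsFeasible q ∧ ∀ q', I.IsFeasible q' → I.cost q ≤ I.cost q'

/-- A list of natural numbers as a word over the three-letter alphabet `Option Bool`: every number
is written in binary (least significant bit first) and followed by the separator `none`. -/
def encodeList (l : List ℕ) : List (Option Bool) :=
  l.flatMap fun n => n.bits.map some ++ [none]

/-- The data of an instance, as a list of natural numbers. -/
def toList (I : FCMJ) : List ℕ :=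
  [I.numMod, I.numComp, (I.root : ℕ)] ++ List.ofFn (fun m => (I.modParent m : ℕ)) ++
    List.ofFn (fun c => (I.compParent c : ℕ)) ++ List.ofFn I.modCost ++ List.ofFn I.compCost ++
    List.ofFn I.limit

/-- The binary encoding of an instance. -/
def encode (I : FCMJ) : List (Option Bool) :=
  encodeList I.toList

/-- There is a polynomial-time exact algorithm for the problem: a Turing machine that, given (the
binary encoding of) any instance, outputs the cycle times of an optimal solution (in binary, in the
order of the components) in time polynomial in the length of the encoding of the instance. -/
def PolyTimeSolvable : Prop :=
  ∃ A : FCMJ → List ℕ,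
    (∀ I : FCMJ, ∃ q : Fin I.numComp → ℕ, I.IsOptimal q ∧ A I = List.ofFn q) ∧
    Nonempty (Turing.TM2ComputableInPolyTime encode encodeList A)

/-- There is a polynomial-time algorithm for integer factorization: a Turing machine that, given a
positive integer `n` in binary, outputs a list of primes (in binary) with product `n`, in time
polynomial in the number of binary digits of `n`. -/
def FactorizationPolyTime : Prop :=
  ∃ F : ℕ → List ℕ,
    (∀ n, n ≠ 0 → (∀ p ∈ F n, p.Prime) ∧ (F n).prod = n) ∧
    Nonempty (Turing.TM2ComputableInPolyTime Nat.bits encodeList F)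

/-- The instance attached to `M`: one module, with setup cost `1`, containing two components with
setup costs `M ^ 2 * (M - 1) - 1` and `0` and cycle limits `M` and `M - 2`. The bound `3 ≤ M` makes
both limits positive (and no subtraction is truncated). -/
abbrev ofNat (M : ℕ) (hM : 3 ≤ M) : FCMJ where
  numMod := 1
  numComp := 2
  root := 0
  modParent := fun _ => 0
  compParent := fun _ => 0
  modCost := fun _ => 1
  compCost := ![M ^ 2 * (M - 1) - 1, 0]
  limit := ![M, M - 2]
  modParent_root := rfl
  reaches_root := fun m => ⟨0, Subsingleton.elim _ _⟩
  not_leaf := fun m => Or.inl ⟨0, Subsingleton.elim _ _⟩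
  limit_pos := fun c => by
    fin_cases c
    · exact Nat.lt_of_lt_of_le (by decide) hM
    · exact Nat.sub_pos_of_lt hM

end FCMJ

/-!
Both parts rest on the two-component instance with setup costs `K₀` (module), `K₁`, `K₂`. On it the
cost rate is `K₁ / q₁ + K₂ / q₂ + K₀ (1 / q₁ + 1 / q₂ - 1 / lcm (q₁, q₂))`.

* If `K₁ ≥ K₀ (M - 1)`, the first component forces `q₁ = M` (`FCMJ.IsOptimal.fst_eq`). Then `q₂`
  minimizes `(K₂ M + K₀ (M - gcd (M, q₂))) / q₂` over `q₂ ≤ M - 2` (`FCMJ.IsOptimal.snd_min`).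
* For `K₀ = 1`, `K₂ = 0` and a composite `M`, the choice `q₂ = M - p`, where `p` is the least prime
  factor, has the value `1`, and every `q₂` coprime to `M` has a larger one. This is part (ii).
* For `K₂ = 1` and `K₀ ≥ M ^ 2`, the optimal solution is unique: `q₂ = M - p` if `M` is composite,
  `q₂ = M - 2` if `M` is prime (`FCMJ.IsOptimal.snd_eq`). So for odd `M` the parity of `q₂` tells
  whether `M` is prime, and if it is not, `M - q₂` is its least prime factor. No gcd is needed.

For part (i) this gives an algorithm that keeps one number `M`: while `M` is even, put out `2` and
halve; when `M` is odd and at least `3`, call the oracle on the instance above, with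
`K₀ = 2 ^ (2 L) - 1` and `K₁ = 2 ^ (3 L) - 1`, where `L` is the number of bits of `M`, so that both
costs are words of ones that can be written without any arithmetic. If `q₂` is odd, put out `M` and
stop; otherwise put out `p = M - q₂` and go on with `M / p`. Since `p` is odd, the exact quotient can
be computed from the lowest bit upwards: its next bit is the lowest bit of the remainder; if that is
`1`, subtract `p`; then drop the lowest bit.

The algorithm is written as a `Turing.TM2` program (`FactorMachine.prog`) that contains the program
of a given oracle machine on separate stacks. The oracle halts with its memory reset and all its
stacks except the output stack empty, and the answer is read off entirely, so the oracle can be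
called again. For each loop there is a lemma that gives its effect and a bound on its number of
steps, by induction on the word that is read. There are at most `L + 1` rounds on numbers of at most
`L` bits, and each takes `FactorMachine.roundTime p L` steps, where `p` is the time bound of the
oracle (`FactorMachine.exists_run`).
-/

/-! ### Instances with one module and two components -/

namespace FCMJ

/-- The instance with one module, of setup cost `K₀`, that contains two components, with setup
costs `K₁` and `K₂` and cycle limits `f₁` and `f₂`. -/
abbrev pair (K₀ K₁ K₂ f₁ f₂ : ℕ) (h₁ : 0 < f₁) (h₂ : 0 < f₂) : FCMJ where
  numMod := 1
  numComp := 2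
  root := 0
  modParent := fun _ => 0
  compParent := fun _ => 0
  modCost := fun _ => K₀
  compCost := ![K₁, K₂]
  limit := ![f₁, f₂]
  modParent_root := rfl
  reaches_root := fun m => ⟨0, Subsingleton.elim _ _⟩
  not_leaf := fun m => Or.inl ⟨0, Subsingleton.elim _ _⟩
  limit_pos := fun c => by
    fin_cases c
    · exact h₁
    · exact h₂

variable {K₀ K₁ K₂ f₁ f₂ : ℕ} {h₁ : 0 < f₁} {h₂ : 0 < f₂}

theorem cost_pair (q : Fin 2 → ℕ) :
    (pair K₀ K₁ K₂ f₁ f₂ h₁ h₂).cost q = (K₁ : ℚ) / q 0 + K₂ / q 1 +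
      K₀ * (1 / q 0 + 1 / q 1 - 1 / (Nat.lcm (q 0) (q 1) : ℕ)) := by
  have hset : ((Finset.univ : Finset (Fin 2)).powerset.filter fun C => C.Nonempty) =
      {{0}, {1}, {0, 1}} := by decide
  have hch : (pair K₀ K₁ K₂ f₁ f₂ h₁ h₂).children 0 = Finset.univ := by
    ext c; simp [children]
  have hne : ({0} : Finset (Fin 2)) ∉ ({{1}, {0, 1}} : Finset (Finset (Fin 2))) := by decide
  have hne' : ({1} : Finset (Fin 2)) ∉ ({{0, 1}} : Finset (Finset (Fin 2))) := by decide
  simp only [cost, Fin.sum_univ_two, Finset.univ_unique, Fin.default_eq_zero, Finset.sum_singleton,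
    hch]
  erw [hset, Finset.sum_insert hne, Finset.sum_insert hne', Finset.sum_singleton]
  simp [Finset.lcm_insert, Finset.lcm_singleton]
  left
  change _ = (q 0 : ℚ)⁻¹ + (q 1 : ℚ)⁻¹ - ((lcm (q 0) (q 1) : ℕ) : ℚ)⁻¹
  ring

theorem isFeasible_pair (q : Fin 2 → ℕ) :
    (pair K₀ K₁ K₂ f₁ f₂ h₁ h₂).IsFeasible q ↔
      (0 < q 0 ∧ q 0 ≤ f₁) ∧ 0 < q 1 ∧ q 1 ≤ f₂ :=
  Fin.forall_fin_two

/-- If the first component is expensive, its cycle time is as long as allowed. -/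
theorem IsOptimal.fst_eq {q : Fin 2 → ℕ} (hq : (pair K₀ K₁ K₂ f₁ f₂ h₁ h₂).IsOptimal q)
    (h0 : 0 < K₀) (hK : K₀ * (f₁ - 1) ≤ K₁) : q 0 = f₁ := by
  obtain ⟨hf, hmin⟩ := hq
  obtain ⟨⟨hp, hle⟩, hp1, hle1⟩ := (isFeasible_pair q).1 hf
  by_contra hne
  have hlt : q 0 + 1 ≤ f₁ := lt_of_le_of_ne hle hne
  have h := hmin ![f₁, q 1] ((isFeasible_pair _).2 ⟨⟨h₁, le_rfl⟩, hp1, hle1⟩)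
  erw [cost_pair, cost_pair] at h
  simp only [Matrix.cons_val_zero, Matrix.cons_val_one] at h
  have e0 : (0 : ℚ) < q 0 := by exact_mod_cast hp
  have eM : (0 : ℚ) < f₁ := by exact_mod_cast h₁
  have a1 : ((K₁ : ℚ) + K₀) / f₁ ≤ K₁ / q 0 := by
    rw [div_le_div_iff₀ eM e0]
    have : (K₁ + K₀) * q 0 ≤ K₁ * f₁ := by
      have e1 : K₀ * q 0 ≤ K₀ * (f₁ - 1) := Nat.mul_le_mul_left _ (by omega)
      nlinarith [Nat.mul_le_mul_left K₁ hlt]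
    exact_mod_cast this
  have a2 : (1 : ℚ) / (Nat.lcm (q 0) (q 1) : ℕ) ≤ 1 / q 0 := by
    apply one_div_le_one_div_of_le e0
    exact_mod_cast Nat.le_of_dvd (Nat.lcm_pos hp hp1) (Nat.dvd_lcm_left _ _)
  have a3 : (0 : ℚ) < 1 / (Nat.lcm f₁ (q 1) : ℕ) := by
    have := Nat.lcm_pos h₁ hp1
    positivity
  have e2 : (0 : ℚ) < K₀ := by exact_mod_cast h0
  rw [add_div] at a1
  have a4 := mul_le_mul_of_nonneg_left a2 e2.le
  have a5 := mul_pos e2 a3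
  have a6 : (K₀ : ℚ) * (1 / f₁) = K₀ / f₁ := by ring
  linarith

/-- Once the first cycle time equals `f₁`, the second one minimizes
`(K₂ f₁ + K₀ (f₁ - gcd (f₁, r))) / r`. -/
theorem IsOptimal.snd_min {q : Fin 2 → ℕ} (hq : (pair K₀ K₁ K₂ f₁ f₂ h₁ h₂).IsOptimal q)
    (h0 : q 0 = f₁) {r : ℕ} (hr : 0 < r) (hr' : r ≤ f₂) :
    (K₂ * f₁ + K₀ * (f₁ - f₁.gcd (q 1))) * r ≤ (K₂ * f₁ + K₀ * (f₁ - f₁.gcd r)) * q 1 := by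
  obtain ⟨hf, hmin⟩ := hq
  obtain ⟨-, hp1, -⟩ := (isFeasible_pair q).1 hf
  have h := hmin ![f₁, r] ((isFeasible_pair _).2 ⟨⟨h₁, le_rfl⟩, hr, hr'⟩)
  erw [cost_pair, cost_pair] at h
  simp only [Matrix.cons_val_zero, Matrix.cons_val_one, h0] at h
  have key : ∀ s : ℕ, 0 < s → (K₁ : ℚ) / f₁ + K₂ / s +
      K₀ * (1 / f₁ + 1 / s - 1 / (Nat.lcm f₁ s : ℕ)) =
      (K₁ + K₀) / f₁ + ((K₂ * f₁ + K₀ * (f₁ - f₁.gcd s) : ℕ) : ℚ) / (s * f₁) := by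
    intro s hs
    have e1 : (Nat.gcd f₁ s : ℚ) * (Nat.lcm f₁ s : ℕ) = f₁ * s := by
      exact_mod_cast Nat.gcd_mul_lcm f₁ s
    have e2 : (0 : ℚ) < (Nat.lcm f₁ s : ℕ) := by exact_mod_cast Nat.lcm_pos h₁ hs
    have e3 : (0 : ℚ) < s := by exact_mod_cast hs
    have e4 : (0 : ℚ) < f₁ := by exact_mod_cast h₁
    have e5 : (1 : ℚ) / (Nat.lcm f₁ s : ℕ) = Nat.gcd f₁ s / (f₁ * s) := by
      rw [div_eq_div_iff e2.ne' (by positivity)]; linarith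
    rw [e5]
    push_cast [Nat.cast_sub (Nat.gcd_le_left s h₁)]
    field_simp
    ring
  rw [key _ hp1, key _ hr, add_le_add_iff_left, div_le_div_iff₀ (by positivity) (by positivity)] at h
  have h' : ((K₂ * f₁ + K₀ * (f₁ - f₁.gcd (q 1))) * r) * f₁ ≤
      ((K₂ * f₁ + K₀ * (f₁ - f₁.gcd r)) * q 1) * f₁ := by
    have : ((K₂ * f₁ + K₀ * (f₁ - f₁.gcd (q 1)) : ℕ) : ℚ) * (r * f₁ : ℕ) ≤
      ((K₂ * f₁ + K₀ * (f₁ - f₁.gcd r) : ℕ) : ℚ) * (q 1 * f₁ : ℕ) := by push_cast at h ⊢; exact h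
    rw [mul_assoc, mul_assoc]
    exact_mod_cast this
  exact Nat.le_of_mul_le_mul_right h' h₁

theorem minFac_le_sub_two {M : ℕ} (h3 : 3 ≤ M) (hM : ¬ M.Prime) :
    2 ≤ M.minFac ∧ M.minFac + 2 ≤ M ∧ M.gcd (M - M.minFac) = M.minFac := by
  have h2 : 2 ≤ M.minFac := (Nat.minFac_prime (by omega)).two_le
  have hsq := Nat.minFac_sq_le_self (by omega) hM
  have hle : M.minFac + 2 ≤ M := by
    by_contra h
    nlinarith
  exact ⟨h2, hle, by
    rw [Nat.gcd_self_sub_right (by omega), Nat.gcd_eq_right (Nat.minFac_dvd M)]⟩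

/-- Part (ii): the value of `M - minFac M` is `1`, so an optimal `q₂ ≤ M - 2` has
`M - gcd (M, q₂) ≤ q₂`, hence `gcd (M, q₂) ≥ 2`. -/
theorem gcd_bounds_of_isOptimal_ofNat (M : ℕ) (hM : 3 ≤ M) (hc : ¬ M.Prime) (q : Fin 2 → ℕ)
    (hq : (ofNat M hM).IsOptimal q) :
    q 0 = M ∧ Nat.gcd (q 1) M ∣ M ∧ 1 < Nat.gcd (q 1) M ∧ Nat.gcd (q 1) M < M := by
  have hq' : (pair 1 (M ^ 2 * (M - 1) - 1) 0 M (M - 2) (by omega) (by omega)).IsOptimal q := hq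
  obtain ⟨-, hp1, hle1⟩ := (isFeasible_pair q).1 hq'.1
  obtain ⟨h2, hle, hgcd⟩ := minFac_le_sub_two hM hc
  have h0 : q 0 = M := by
    refine hq'.fst_eq one_pos ?_
    rw [one_mul]
    have : 2 * (M - 1) ≤ M ^ 2 * (M - 1) := Nat.mul_le_mul_right _ (by nlinarith)
    omega
  have h := hq'.snd_min h0 (r := M - M.minFac) (by omega) (by omega)
  rw [hgcd] at h
  simp only [zero_mul, zero_add, one_mul] at h
  rw [mul_comm] at h
  have h' := Nat.le_of_mul_le_mul_left h (by omega)
  rw [Nat.gcd_comm]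
  have hlt : M.gcd (q 1) ≤ q 1 := Nat.gcd_le_right _ hp1
  exact ⟨h0, Nat.gcd_dvd_left _ _, by omega, by omega⟩

/-- With a small positive cost on the second component, ties between divisors are broken in favour
of the largest cycle time: the optimal solution reveals the least prime factor of `M`. -/
theorem IsOptimal.snd_eq {M : ℕ} {h₁ : 0 < M} {h₂ : 0 < M - 2} {q : Fin 2 → ℕ}
    (hq : (pair K₀ K₁ 1 M (M - 2) h₁ h₂).IsOptimal q)
    (hK₀ : M ^ 2 ≤ K₀) (hK : K₀ * (M - 1) ≤ K₁) :
    q 0 = M ∧ q 1 = M - if M.Prime then 2 else M.minFac := by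
  have hM : 3 ≤ M := by omega
  have h0 := hq.fst_eq (lt_of_lt_of_le (by positivity) hK₀) hK
  refine ⟨h0, ?_⟩
  obtain ⟨-, hp1, hle1⟩ := (isFeasible_pair q).1 hq.1
  have hg1 : 0 < M.gcd (q 1) := Nat.gcd_pos_of_pos_left _ h₁
  have hgM := Nat.gcd_dvd_left M (q 1)
  split_ifs with hc
  · have h := hq.snd_min h0 (r := M - 2) (by omega) le_rfl
    have hcop : ∀ r, 0 < r → r ≤ M - 2 → M.gcd r = 1 := fun r hr hr' =>
      (Nat.Prime.coprime_iff_not_dvd hc).2 fun hd => by have := Nat.le_of_dvd hr hd; omega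
    rw [hcop _ hp1 hle1, hcop _ (by omega) le_rfl] at h
    have := Nat.le_of_mul_le_mul_left h (by positivity)
    omega
  · obtain ⟨h2, hle, hgcd⟩ := minFac_le_sub_two hM hc
    have h := hq.snd_min h0 (r := M - M.minFac) (by omega) (by omega)
    rw [hgcd] at h
    have hgq : M.gcd (q 1) ∣ M - q 1 := Nat.dvd_sub hgM (Nat.gcd_dvd_right _ _)
    have hge : M.gcd (q 1) ≤ M - q 1 := Nat.le_of_dvd (by omega) hgq
    set g := M.gcd (q 1)
    obtain ⟨k, hk⟩ : ∃ k, M - g = q 1 + k := ⟨M - g - q 1, by omega⟩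
    obtain ⟨r, hr⟩ : ∃ r, r = M - M.minFac := ⟨_, rfl⟩
    rw [← hr, hk, one_mul] at h
    have hr1 : 1 ≤ r := by omega
    -- `k` measures how far `q 1` falls short of `M - g`, the largest multiple of `g` below `M`.
    rcases Nat.eq_zero_or_pos k with rfl | hkpos
    · have hrq : M * r ≤ M * q 1 := by nlinarith
      have := Nat.le_of_mul_le_mul_left hrq h₁
      have := Nat.minFac_le_of_dvd (by omega : 2 ≤ g) hgM
      omega
    · -- Falling short costs at least `K₀ ≥ M ^ 2`, more than the term of `K₂ = 1` can gain.
      exfalso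
      have e1 : K₀ ≤ K₀ * k * r := by
        rw [mul_assoc]
        exact Nat.le_mul_of_pos_right _ (Nat.mul_pos hkpos hr1)
      have e2 : M * q 1 < M ^ 2 := by
        rw [sq]
        exact Nat.mul_lt_mul_of_pos_left (by omega) h₁
      nlinarith

end FCMJ

/-! ### Binary words -/

/-- The number denoted by a binary word, least significant bit first. Unlike the words `Nat.bits n`,
the word may end in zeros. -/
def bitsVal : List Bool → ℕ
  | [] => 0
  | b :: l => b.toNat + 2 * bitsVal l

/-- Removal of the leading zeros of a word that is written most significant bit first. -/
def stripZeros : List Bool → List Bool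
  | [] => []
  | false :: l => stripZeros l
  | true :: l => true :: l

/-- Bitwise subtraction with borrow `c` of two words written least significant bit first; the shorter
one is padded with zeros. -/
def subBits : List Bool → List Bool → Bool → List Bool
  | [], [], _ => []
  | x :: l, [], c => (x ^^ c) :: subBits l [] (!x && c)
  | [], y :: l', c => (y ^^ c) :: subBits [] l' (y || c)
  | x :: l, y :: l', c => (x ^^ y ^^ c) :: subBits l l' (!x && (y || c) || y && c)

theorem bits_cons (b : Bool) (n : ℕ) (h : b = true ∨ n ≠ 0) :
    Nat.bits (b.toNat + 2 * n) = b :: n.bits := by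
  have := Nat.bits_append_bit n b (fun hn => h.resolve_right (not_not.2 hn))
  rwa [Nat.bit_val, add_comm] at this

theorem bitsVal_bits (n : ℕ) : bitsVal n.bits = n := by
  induction n using Nat.binaryRec' with
  | zero => simp [bitsVal]
  | bit b n h ih =>
    rw [Nat.bits_append_bit n b h, bitsVal, ih, Nat.bit_val, add_comm]

theorem bitsVal_append_singleton (l : List Bool) (b : Bool) :
    bitsVal (l ++ [b]) = bitsVal l + 2 ^ l.length * b.toNat := by
  induction l with
  | nil => simp [bitsVal]
  | cons x l ih => simp only [List.cons_append, bitsVal, ih, List.length_cons]; ring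

theorem bits_bitsVal_append_true (l : List Bool) : (bitsVal (l ++ [true])).bits = l ++ [true] := by
  induction l with
  | nil => simp [bitsVal]
  | cons x l ih =>
    rw [List.cons_append, bitsVal, bits_cons, ih]
    right
    rw [bitsVal_append_singleton]
    simp

/-- Removing the leading zeros gives the canonical binary word. -/
theorem reverse_stripZeros (l : List Bool) :
    (stripZeros l).reverse = (bitsVal l.reverse).bits := by
  induction l with
  | nil => simp [stripZeros, bitsVal]
  | cons x l ih =>
    cases x
    · rw [stripZeros, ih, List.reverse_cons, bitsVal_append_singleton]
      simp
    · rw [stripZeros, List.reverse_cons, bits_bitsVal_append_true]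

theorem length_stripZeros_le (l : List Bool) : (stripZeros l).length ≤ l.length := by
  induction l with
  | nil => simp [stripZeros]
  | cons x l ih => cases x <;> simp [stripZeros]; omega

theorem bitsVal_lt (l : List Bool) : bitsVal l < 2 ^ l.length := by
  induction l with
  | nil => simp [bitsVal]
  | cons x l ih =>
    have := Bool.toNat_le x
    rw [bitsVal, List.length_cons, pow_succ]
    omega

theorem length_subBits (l l' : List Bool) (c : Bool) :
    (subBits l l' c).length = max l.length l'.length := by
  fun_induction subBits l l' c <;> simp_all

theorem bitsVal_subBits (l l' : List Bool) (c : Bool) (h : bitsVal l' + c.toNat ≤ bitsVal l) :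
    bitsVal (subBits l l' c) + (bitsVal l' + c.toNat) = bitsVal l := by
  fun_induction subBits l l' c with
  | case1 c => simp_all [bitsVal]
  | case2 x l c ih | case3 x l c ih =>
    cases c <;> cases x <;> simp only [bitsVal, Bool.toNat_true, Bool.toNat_false, Bool.not_true,
      Bool.not_false, Bool.false_and, Bool.true_and, Bool.false_or, Bool.true_or, Bool.xor_false,
      Bool.xor_true] at h ih ⊢ <;> omega
  | case4 x l y l' c ih =>
    cases c <;> cases x <;> cases y <;> simp only [bitsVal, Bool.toNat_true, Bool.toNat_false,
      Bool.not_true, Bool.not_false, Bool.false_and, Bool.true_and,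
      Bool.xor_false, Bool.xor_true, Bool.or_false, Bool.or_true] at h ih ⊢ <;> omega

theorem bits_two_pow_sub_one (k : ℕ) : (2 ^ k - 1).bits = List.replicate k true := by
  induction k with
  | zero => simp
  | succ k ih =>
    have h : 2 ^ (k + 1) - 1 = true.toNat + 2 * (2 ^ k - 1) := by
      have := Nat.one_le_two_pow (n := k)
      simp only [Bool.toNat_true, pow_succ]
      omega
    rw [h, bits_cons _ _ (Or.inl rfl), ih, List.replicate_succ]

theorem length_bits_mono {a b : ℕ} (h : a ≤ b) : a.bits.length ≤ b.bits.length := by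
  rw [Nat.size_eq_bits_len, Nat.size_eq_bits_len]
  exact Nat.size_le_size h

theorem length_bits_bitsVal_le (l : List Bool) : (bitsVal l).bits.length ≤ l.length := by
  rw [Nat.size_eq_bits_len, Nat.size_le]
  exact bitsVal_lt l

/-! ### Bounded runs of a transition function -/

open Turing StateTransition

/-- The transition function `f` leads from `a` to `b` in at most `t` steps. -/
def RunsIn {σ : Type*} (f : σ → Option σ) (t : ℕ) (a b : σ) : Prop :=
  ∃ n ≤ t, (flip bind f)^[n] (some a) = some b

namespace RunsIn

variable {σ τ : Type*} {f : σ → Option σ} {a b c : σ} {s t : ℕ}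

theorem refl (a : σ) : RunsIn f 0 a a := ⟨0, le_rfl, rfl⟩

theorem step (h : f a = some b) : RunsIn f 1 a b := ⟨1, le_rfl, h⟩

theorem trans (h : RunsIn f s a b) (h' : RunsIn f t b c) : RunsIn f (s + t) a c := by
  obtain ⟨m, hm, h⟩ := h
  obtain ⟨n, hn, h'⟩ := h'
  exact ⟨n + m, by omega, by rw [Function.iterate_add_apply, h, h']⟩

theorem head (h : f a = some b) (h' : RunsIn f t b c) : RunsIn f (t + 1) a c :=
  add_comm 1 t ▸ (step h).trans h'

theorem mono (h : RunsIn f s a b) (hst : s ≤ t) : RunsIn f t a b :=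
  let ⟨n, hn, e⟩ := h
  ⟨n, hn.trans hst, e⟩

theorem iterate_none (n : ℕ) : (flip bind f)^[n] none = none := by
  induction n with
  | zero => rfl
  | succ n ih => rw [Function.iterate_succ_apply]; exact ih

/-- Runs are preserved by a simulation of single steps. -/
theorem map {g : τ → Option τ} {φ : σ → τ} (hφ : ∀ a b, f a = some b → g (φ a) = some (φ b))
    (h : RunsIn f t a b) : RunsIn g t (φ a) (φ b) := by
  obtain ⟨n, hn, h⟩ := h
  refine ⟨n, hn, ?_⟩
  clear hn
  induction n generalizing a with
  | zero => rw [Function.iterate_zero_apply] at h ⊢; rw [Option.some.inj h]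
  | succ n ih =>
    rw [Function.iterate_succ_apply] at h ⊢
    change (flip bind f)^[n] (f a) = _ at h
    change (flip bind g)^[n] (g (φ a)) = _
    cases hfa : f a with
    | none => rw [hfa, iterate_none] at h; cases h
    | some a' => rw [hfa] at h; rw [hφ _ _ hfa]; exact ih h

theorem nonempty_evalsToInTime (h : RunsIn f t a b) : Nonempty (EvalsToInTime f a (some b) t) :=
  let ⟨n, hn, e⟩ := h
  ⟨⟨⟨n, e⟩, hn⟩⟩

end RunsIn

theorem StateTransition.EvalsToInTime.runsIn {σ : Type*} {f : σ → Option σ} {a b : σ} {t : ℕ}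
    (h : EvalsToInTime f a (some b) t) : RunsIn f t a b :=
  ⟨h.steps, h.steps_le_m, h.evals_in_steps⟩

/-! ### The factoring machine -/

namespace FactorMachine

/-- The stacks of bits of the factoring machine. Numbers are stored with the least significant bit
on top. Stack `m` holds the current number `M` (the remainder, during a division), `d` the number to
subtract or to divide by, `e` the bits of the quotient, most recent first; `a` and `b` hold reversed
words: a preserved operand and a difference. -/
inductive Reg
  | m | a | b | d | e
  deriving DecidableEq

instance : Fintype Reg := ⟨{.m, .a, .b, .d, .e}, fun r => by cases r <;> decide⟩

/-- What a bitwise subtraction is used for: to compute `M - 2`, to compute the prime factor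
`M - q₂`, or for one step of the division. -/
inductive Use
  | limit | factor | quotient
  deriving DecidableEq

instance : Fintype Use := ⟨{.limit, .factor, .quotient}, fun u => by cases u <;> decide⟩

/-- The labels of the factoring machine, apart from those of the oracle. A round begins at `start`;
`sub` is the subtraction loop; `stripLimit` to `writeModCost` write the instance; `skipFst` to
`loadSnd` read the answer; `skipSnd` to `writePrime` put out a prime `M`; the remaining ones put out
a prime factor of `M` and compute the quotient. -/
inductive Lab
  | start | sub (u : Use)
  | stripLimit | writeLimit | writeNumber | writeCost | writeModCost
  | skipFst | readSnd | readRest | loadSnd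
  | skipSnd | turnPrime | writePrime
  | stripFactor | writeFactor | restore
  | divide | restoreRem | restoreDiv | clearDiv | stripQuotient | loadQuotient
  deriving DecidableEq, Fintype

/-- The local memory. -/
structure Mem where
  /-- the last symbol read, `none` at the end of a word -/
  x : Option Bool
  /-- the last symbol read from the second operand of a subtraction -/
  y : Option Bool
  /-- the borrow of a subtraction -/
  c : Bool
  deriving DecidableEq, Fintype

variable (A : FinTM2) (ι : A.Γ A.k₀ ≃ Option Bool) (ο : A.Γ A.k₁ ≃ Option Bool)

/-- The stacks: bit stacks, the output stack, and the stacks of the oracle `A`. -/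
abbrev Stk : Type := Reg ⊕ Option A.K

/-- The stack alphabets. The output alphabet has the separator `none`. -/
def Alph : Stk A → Type
  | .inl _ => Bool
  | .inr none => Option Bool
  | .inr (some k) => A.Γ k

/-- Memory states: the local memory and the memory of the oracle. -/
abbrev St : Type := Mem × A.σ
/-- All labels. -/
abbrev Lb : Type := Lab ⊕ A.Λ
/-- Statements. -/
abbrev Prog : Type := TM2.Stmt (Alph A) (Lb A) (St A)

variable {A}

section Statements

open TM2.Stmt

/-- Pop a bit stack into `x`. -/
def popX (r : Reg) (p : Prog A) : Prog A :=
  pop (.inl r) (fun v o => (⟨o, v.1.y, v.1.c⟩, v.2)) p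

/-- Pop a bit stack into `y`. -/
def popY (r : Reg) (p : Prog A) : Prog A :=
  pop (.inl r) (fun v o => (⟨v.1.x, o, v.1.c⟩, v.2)) p

/-- Copy the top of a bit stack into `x`. -/
def peekX (r : Reg) (p : Prog A) : Prog A :=
  peek (.inl r) (fun v o => (⟨o, v.1.y, v.1.c⟩, v.2)) p

/-- Push a bit that depends on the local memory. -/
def pushReg (r : Reg) (f : Mem → Bool) (p : Prog A) : Prog A :=
  push (.inl r) (fun v => f v.1) p

/-- Push a symbol on the output stack. -/
def pushOut (f : Mem → Option Bool) (p : Prog A) : Prog A :=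
  push (.inr none) (fun v => f v.1) p

/-- Push a symbol on the input stack of the oracle. -/
def pushIn (f : Mem → Option Bool) (p : Prog A) : Prog A :=
  push (.inr (some A.k₀)) (fun v => ι.symm (f v.1)) p

/-- Pop a symbol that the oracle has put out into `x`; the separator is read as `none`. -/
def popAns (p : Prog A) : Prog A :=
  pop (.inr (some A.k₁)) (fun v o => (⟨(o.map ο).join, v.1.y, v.1.c⟩, v.2)) p

/-- Branch on whether the end of a word has been reached (`p₀`) or not (`p₁`). -/
def onX (p₀ p₁ : Prog A) : Prog A :=
  branch (fun v => v.1.x.isSome) p₁ p₀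

/-- Branch on the bit in `x`. -/
def ifX (p₀ p₁ : Prog A) : Prog A :=
  branch (fun v => v.1.x.getD false) p₁ p₀

/-- Jump to a label, forgetting the bits read but not the borrow. -/
def go (l : Lab) : Prog A :=
  load (fun v => (⟨none, none, v.1.c⟩, v.2)) (goto fun _ => .inl l)

/-- Halt with the memory in its initial state. -/
def finish : Prog A :=
  load (fun v => (⟨none, none, false⟩, v.2)) halt

/-- The current bit of the difference; an operand that has ended is padded with zeros. -/
def diff (v : Mem) : Bool := v.x.getD false ^^ v.y.getD false ^^ v.c

/-- The next borrow. -/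
def borrow (v : Mem) : Bool :=
  !v.x.getD false && (v.y.getD false || v.c) || v.y.getD false && v.c

/-- The bit in `x`. -/
def xb (v : Mem) : Bool := v.x.getD false

/-- The bit in `y`. -/
def yb (v : Mem) : Bool := v.y.getD false

/-- A statement of the oracle; where the oracle halts, its answer is read. -/
def sim : TM2.Stmt A.Γ A.Λ A.σ → Prog A
  | push k f p => push (.inr (some k)) (fun v => f v.2) (sim p)
  | peek k f p => peek (.inr (some k)) (fun v o => (v.1, f v.2 o)) (sim p)
  | pop k f p => pop (.inr (some k)) (fun v o => (v.1, f v.2 o)) (sim p)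
  | load f p => load (fun v => (v.1, f v.2)) (sim p)
  | branch f p p' => branch (fun v => f v.2) (sim p) (sim p')
  | goto f => goto fun v => .inr (f v.2)
  | halt => goto fun _ => .inl .skipFst

/-- The program; `ι` and `ο` identify the input and output alphabets of the oracle. As stacks are last in,
first out, the word of the instance is written from its end: the limits `M - 2` and `M`, the costs
`1`, `K₁`, `K₀`, and the header that does not depend on `M`. -/
def prog : Lb A → Prog A
  | .inr l => sim (A.m l)
  -- `0` and `1` have no prime factors; an even number is halved by the pop itself.
  | .inl .start => popX .m <| onX finish <|
      ifX
        (pushOut (fun _ => none) <| pushOut (fun _ => some true) <|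
          pushOut (fun _ => some false) <| go .start)
        (peekX .m <| onX finish <| pushReg .m (fun _ => true) <| pushReg .d (fun _ => true) <|
          pushReg .d (fun _ => false) <| go (.sub .limit))
  | .inl (.sub u) => popX .m <| popY .d <|
      branch (fun v => v.1.x.isSome || v.1.y.isSome)
        (pushReg .b diff <|
          -- The operand that is needed again is copied to stack `a`.
          let next := load (fun v => (⟨none, none, borrow v.1⟩, v.2)) <| go (.sub u)
          match u with
          | .quotient => branch (fun v => v.1.y.isSome) (pushReg .a yb next) next
          | _ => onX next (pushReg .a xb next))
        (load (fun v => (⟨none, none, false⟩, v.2)) <|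
          match u with
          | .limit => pushIn ι (fun _ => none) <| go .stripLimit
          | .factor => pushOut (fun _ => none) <| go .stripFactor
          | .quotient => go .restoreRem)
  | .inl .stripLimit => popX .b <| onX (go .writeLimit) <|
      ifX (go .stripLimit) (pushReg .b (fun _ => true) <| go .writeLimit)
  | .inl .writeLimit => popX .b <| onX (pushIn ι (fun _ => none) <| go .writeNumber) <|
      pushIn ι Mem.x <| go .writeLimit
  | .inl .writeNumber => popX .a <|
      onX (pushIn ι (fun _ => none) <| pushIn ι (fun _ => some true) <| pushIn ι (fun _ => none) <|
        go .writeCost) <|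
      pushReg .m xb <| pushIn ι Mem.x <| go .writeNumber
  -- Three ones per bit of `M` give `K₁`, and two ones per bit give `K₀`.
  | .inl .writeCost => popX .m <| onX (pushIn ι (fun _ => none) <| go .writeModCost) <|
      pushReg .a xb <| pushIn ι (fun _ => some true) <| pushIn ι (fun _ => some true) <|
      pushIn ι (fun _ => some true) <| go .writeCost
  | .inl .writeModCost => popX .a <|
      onX (pushIn ι (fun _ => none) <| pushIn ι (fun _ => none) <| pushIn ι (fun _ => none) <|
        pushIn ι (fun _ => none) <| pushIn ι (fun _ => none) <|
        pushIn ι (fun _ => some true) <| pushIn ι (fun _ => some false) <|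
        pushIn ι (fun _ => none) <| pushIn ι (fun _ => some true) <|
        load (fun v => (⟨none, none, v.1.c⟩, v.2)) <| goto fun _ => .inr A.main) <|
      pushReg .m xb <| pushIn ι (fun _ => some true) <| pushIn ι (fun _ => some true) <|
      go .writeModCost
  | .inl .skipFst => popAns ο <| onX (go .readSnd) (go .skipFst)
  -- The lowest bit of `q₂` is `0` exactly if `M` is composite.
  | .inl .readSnd => popAns ο <| ifX (pushReg .a (fun _ => false) <| go .readRest) (go .skipSnd)
  | .inl .readRest => popAns ο <| onX (go .loadSnd) (pushReg .a xb <| go .readRest)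
  | .inl .loadSnd => popX .a <| onX (go (.sub .factor)) (pushReg .d xb <| go .loadSnd)
  | .inl .skipSnd => popAns ο <| onX (pushOut (fun _ => none) <| go .turnPrime) (go .skipSnd)
  | .inl .turnPrime => popX .m <| onX (go .writePrime) (pushReg .a xb <| go .turnPrime)
  | .inl .writePrime => popX .a <| onX finish (pushOut Mem.x <| go .writePrime)
  | .inl .stripFactor => popX .b <| onX (go .writeFactor) <|
      ifX (go .stripFactor) (pushReg .b (fun _ => true) <| go .writeFactor)
  | .inl .writeFactor => popX .b <| onX (go .restore) <|
      pushReg .d xb <| pushOut Mem.x <| go .writeFactor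
  | .inl .restore => popX .a <| onX (go .divide) (pushReg .m xb <| go .restore)
  -- The lowest bit of the remainder is the next bit of the quotient.
  | .inl .divide => popX .m <| onX (go .clearDiv) <|
      ifX (pushReg .e (fun _ => false) <| go .divide)
        (pushReg .e (fun _ => true) <| pushReg .m (fun _ => true) <| go (.sub .quotient))
  | .inl .restoreRem => popX .b <| onX (popX .m <| go .restoreDiv) (pushReg .m xb <| go .restoreRem)
  | .inl .restoreDiv => popX .a <| onX (go .divide) (pushReg .d xb <| go .restoreDiv)
  | .inl .clearDiv => popX .d <| onX (go .stripQuotient) (go .clearDiv)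
  -- The oracle expects words without leading zeros.
  | .inl .stripQuotient => popX .e <| onX (go .loadQuotient) <|
      ifX (go .stripQuotient) (pushReg .e (fun _ => true) <| go .loadQuotient)
  | .inl .loadQuotient => popX .e <| onX (go .start) (pushReg .m xb <| go .loadQuotient)

end Statements

/-- Contents of the bit stacks. -/
def regs (m a b d e : List Bool) : Reg → List Bool
  | .m => m
  | .a => a
  | .b => b
  | .d => d
  | .e => e

/-- Contents of all stacks. -/
def stks (R : Reg → List Bool) (o : List (Option Bool)) (S : ∀ k, List (A.Γ k)) :
    ∀ k, List (Alph A k)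
  | .inl r => R r
  | .inr none => o
  | .inr (some k) => S k

/-- Contents of the oracle's stacks when only stack `k` is in use. -/
def only (k : A.K) (l : List (A.Γ k)) : ∀ k, List (A.Γ k) :=
  Function.update (fun _ => []) k l

/-- The oracle's stacks with the word `s` on its input stack. -/
def query (s : List (Option Bool)) : ∀ k, List (A.Γ k) := only A.k₀ (s.map ι.symm)

/-- The oracle's stacks with the word `s` on its output stack. -/
def answer (s : List (Option Bool)) : ∀ k, List (A.Γ k) := only A.k₁ (s.map ο.symm)

/-- A running configuration between two statements: no bit is in the local memory, and the oracle's
memory is in its initial state. -/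
abbrev cfg (l : Lb A) (c : Bool) (R : Reg → List Bool) (o : List (Option Bool))
    (S : ∀ k, List (A.Γ k)) : TM2.Cfg (Alph A) (Lb A) (St A) :=
  ⟨some l, (⟨none, none, c⟩, A.initialState), stks R o S⟩

section Lemmas
variable (R : Reg → List Bool) (o : List (Option Bool)) (S : ∀ k, List (A.Γ k))

@[simp] theorem update_stks_reg (r : Reg) (l : List Bool) :
    Function.update (stks R o S) (.inl r) l = stks (Function.update R r l) o S := by
  funext k
  rcases k with k | _ | k
  · by_cases h : k = r
    · subst h
      exact (Function.update_self ..).trans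
        (show Function.update R k l k = l from Function.update_self ..).symm
    · exact (Function.update_of_ne (by simpa using h) ..).trans
        (show R k = Function.update R r l k from (Function.update_of_ne h ..).symm)
  · rfl
  · rfl

@[simp] theorem update_stks_out (l : List (Option Bool)) :
    Function.update (stks R o S) (.inr none) l = stks R l S := by
  funext k
  rcases k with k | _ | k <;> rfl

@[simp] theorem update_stks_oracle (k : A.K) (l : List (A.Γ k)) :
    Function.update (stks R o S) (.inr (some k)) l = stks R o (Function.update S k l) := by
  funext k'
  rcases k' with k' | _ | k'
  · rfl
  · rfl
  · by_cases h : k' = k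
    · subst h
      exact (Function.update_self ..).trans
        (show Function.update S k' l k' = l from Function.update_self ..).symm
    · exact (Function.update_of_ne (by simpa using h) ..).trans
        (show S k' = Function.update S k l k' from (Function.update_of_ne h ..).symm)

@[simp] theorem only_self (k : A.K) (l : List (A.Γ k)) : only k l k = l :=
  Function.update_self ..

@[simp] theorem update_only (k : A.K) (l l' : List (A.Γ k)) :
    Function.update (only k l) k l' = only k l' :=
  Function.update_idem ..

variable (m a b d e l : List Bool)

@[simp] theorem regs_m : regs m a b d e .m = m := rfl
@[simp] theorem regs_a : regs m a b d e .a = a := rfl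
@[simp] theorem regs_b : regs m a b d e .b = b := rfl
@[simp] theorem regs_d : regs m a b d e .d = d := rfl
@[simp] theorem regs_e : regs m a b d e .e = e := rfl

@[simp] theorem update_m : Function.update (regs m a b d e) .m l = regs l a b d e := by
  funext r; cases r <;> rfl
@[simp] theorem update_a : Function.update (regs m a b d e) .a l = regs m l b d e := by
  funext r; cases r <;> rfl
@[simp] theorem update_b : Function.update (regs m a b d e) .b l = regs m a l d e := by
  funext r; cases r <;> rfl
@[simp] theorem update_d : Function.update (regs m a b d e) .d l = regs m a b l e := by
  funext r; cases r <;> rfl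
@[simp] theorem update_e : Function.update (regs m a b d e) .e l = regs m a b d l := by
  funext r; cases r <;> rfl

end Lemmas

/-! ### Effect of the statements -/

section Semantics

variable (p p₀ p₁ : Prog A) (v : Mem) (w : A.σ) (R : Reg → List Bool) (o : List (Option Bool))
  (S : ∀ k, List (A.Γ k))

@[simp] theorem stepAux_popX (r : Reg) : TM2.stepAux (popX r p) (v, w) (stks R o S) =
    TM2.stepAux p (⟨(R r).head?, v.y, v.c⟩, w) (stks (Function.update R r (R r).tail) o S) := by
  rw [← update_stks_reg]; rfl

@[simp] theorem stepAux_popY (r : Reg) : TM2.stepAux (popY r p) (v, w) (stks R o S) =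
    TM2.stepAux p (⟨v.x, (R r).head?, v.c⟩, w) (stks (Function.update R r (R r).tail) o S) := by
  rw [← update_stks_reg]; rfl

@[simp] theorem stepAux_peekX (r : Reg) : TM2.stepAux (peekX r p) (v, w) (stks R o S) =
    TM2.stepAux p (⟨(R r).head?, v.y, v.c⟩, w) (stks R o S) := rfl

@[simp] theorem stepAux_pushReg (r : Reg) (f : Mem → Bool) :
    TM2.stepAux (pushReg r f p) (v, w) (stks R o S) =
      TM2.stepAux p (v, w) (stks (Function.update R r (f v :: R r)) o S) := by
  rw [← update_stks_reg]; rfl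

@[simp] theorem stepAux_pushOut (f : Mem → Option Bool) :
    TM2.stepAux (pushOut f p) (v, w) (stks R o S) =
      TM2.stepAux p (v, w) (stks R (f v :: o) S) := by
  exact congrArg (TM2.stepAux p (v, w)) (update_stks_out R o S (f v :: o))

@[simp] theorem stepAux_pushIn (f : Mem → Option Bool) (s : List (Option Bool)) :
    TM2.stepAux (pushIn ι f p) (v, w) (stks R o (query ι s)) =
      TM2.stepAux p (v, w) (stks R o (query ι (f v :: s))) := by
  refine congrArg (TM2.stepAux p (v, w)) ((update_stks_oracle R o _ A.k₀
    (ι.symm (f v) :: only A.k₀ (s.map ι.symm) A.k₀)).trans ?_)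
  unfold query
  rw [only_self, update_only, List.map_cons]

@[simp] theorem stepAux_popAns (s : List (Option Bool)) :
    TM2.stepAux (popAns ο p) (v, w) (stks R o (answer ο s)) =
      TM2.stepAux p (⟨s.head?.join, v.y, v.c⟩, w) (stks R o (answer ο s.tail)) := by
  unfold answer
  have h : (only A.k₁ (s.map ο.symm) A.k₁).head?.map ο = s.head? := by
    rw [only_self]
    cases s <;> simp
  calc
    _ = TM2.stepAux p (⟨((only A.k₁ (s.map ο.symm) A.k₁).head?.map ο).join, v.y, v.c⟩, w)
          (Function.update (stks R o (only A.k₁ (s.map ο.symm))) (.inr (some A.k₁))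
            (only A.k₁ (s.map ο.symm) A.k₁).tail) := rfl
    _ = _ := by rw [h, update_stks_oracle, only_self, update_only, List.map_tail]

@[simp] theorem stepAux_onX : TM2.stepAux (onX p₀ p₁) (v, w) (stks R o S) =
    if v.x.isSome then TM2.stepAux p₁ (v, w) (stks R o S)
    else TM2.stepAux p₀ (v, w) (stks R o S) := by
  cases h : v.x.isSome <;> simp [onX, TM2.stepAux, h]

@[simp] theorem stepAux_ifX : TM2.stepAux (ifX p₀ p₁) (v, w) (stks R o S) =
    if v.x.getD false then TM2.stepAux p₁ (v, w) (stks R o S)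
    else TM2.stepAux p₀ (v, w) (stks R o S) := by
  cases h : v.x.getD false <;> simp [ifX, TM2.stepAux, h]

@[simp] theorem stepAux_go (l : Lab) : TM2.stepAux (go l) (v, w) (stks R o S) =
    ⟨some (.inl l), (⟨none, none, v.c⟩, w), stks R o S⟩ := rfl

@[simp] theorem stepAux_finish : TM2.stepAux finish (v, w) (stks R o S) =
    ⟨none, (⟨none, none, false⟩, w), stks R o S⟩ := rfl

end Semantics

local notation "stepM" => TM2.step (prog ι ο)

attribute [local simp] prog diff borrow xb yb

/-! ### The loops of the program -/

section Loops

variable (m a b d e : List Bool) (o : List (Option Bool)) (S : ∀ k, List (A.Γ k))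

theorem run_stripLimit :
    RunsIn stepM (b.length + 1) (cfg (.inl .stripLimit) false (regs m a b d e) o S)
      (cfg (.inl .writeLimit) false (regs m a (stripZeros b) d e) o S) := by
  induction b with
  | nil => exact RunsIn.step (by simp [stripZeros])
  | cons x b ih =>
    cases x
    · exact RunsIn.head (by simp) ih
    · exact (RunsIn.step (by simp [stripZeros])).mono (by simp)

theorem run_stripFactor :
    RunsIn stepM (b.length + 1) (cfg (.inl .stripFactor) false (regs m a b d e) o S)
      (cfg (.inl .writeFactor) false (regs m a (stripZeros b) d e) o S) := by
  induction b with
  | nil => exact RunsIn.step (by simp [stripZeros])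
  | cons x b ih =>
    cases x
    · exact RunsIn.head (by simp) ih
    · exact (RunsIn.step (by simp [stripZeros])).mono (by simp)

theorem run_stripQuotient :
    RunsIn stepM (e.length + 1) (cfg (.inl .stripQuotient) false (regs m a b d e) o S)
      (cfg (.inl .loadQuotient) false (regs m a b d (stripZeros e)) o S) := by
  induction e with
  | nil => exact RunsIn.step (by simp [stripZeros])
  | cons x b ih =>
    cases x
    · exact RunsIn.head (by simp) ih
    · exact (RunsIn.step (by simp [stripZeros])).mono (by simp)

theorem run_writeLimit (s : List (Option Bool)) :
    RunsIn stepM (b.length + 1)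
      (cfg (.inl .writeLimit) false (regs m a b d e) o (query ι s))
      (cfg (.inl .writeNumber) false (regs m a [] d e) o
        (query ι (none :: (b.reverse.map some ++ s)))) := by
  induction b generalizing s with
  | nil => exact RunsIn.step (by simp)
  | cons x b ih => exact RunsIn.head (by simp; rfl) (by simpa using ih (some x :: s))

theorem run_writeNumber (s : List (Option Bool)) :
    RunsIn stepM (a.length + 1)
      (cfg (.inl .writeNumber) false (regs m a b d e) o (query ι s))
      (cfg (.inl .writeCost) false (regs (a.reverse ++ m) [] b d e) o
        (query ι (none :: some true :: none :: (a.reverse.map some ++ s)))) := by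
  induction a generalizing s m with
  | nil => exact RunsIn.step (by simp)
  | cons x a ih => exact RunsIn.head (by simp; rfl) (by simpa using ih (x :: m) (some x :: s))

theorem run_writeCost (s : List (Option Bool)) :
    RunsIn stepM (m.length + 1)
      (cfg (.inl .writeCost) false (regs m a b d e) o (query ι s))
      (cfg (.inl .writeModCost) false (regs [] (m.reverse ++ a) b d e) o
        (query ι (none :: (List.replicate (3 * m.length) (some true) ++ s)))) := by
  induction m generalizing s a with
  | nil => exact RunsIn.step (by simp)
  | cons x m ih =>
    refine RunsIn.head (by simp) (b := cfg (.inl .writeCost) false (regs m (x :: a) b d e) o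
      (query ι (List.replicate 3 (some true) ++ s))) ?_
    have h := ih (x :: a) (List.replicate 3 (some true) ++ s)
    rwa [← List.append_assoc, ← List.replicate_add, ← mul_add_one, List.append_cons,
      ← List.reverse_cons] at h

/-- The part of the encoded instance in front of the costs and limits: one module, two components,
the root and all parents equal to `0`, that is, the list `[1, 2, 0, 0, 0, 0]`. -/
def headerWord : List (Option Bool) :=
  [some true, none, some false, some true, none, none, none, none, none]

theorem run_writeModCost (s : List (Option Bool)) :
    RunsIn stepM (a.length + 1)
      (cfg (.inl .writeModCost) false (regs m a b d e) o (query ι s))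
      (cfg (.inr A.main) false (regs (a.reverse ++ m) [] b d e) o
        (query ι (headerWord ++ (List.replicate (2 * a.length) (some true) ++ s)))) := by
  induction a generalizing s m with
  | nil => exact RunsIn.step (by simp [headerWord, TM2.stepAux])
  | cons x a ih =>
    refine RunsIn.head (by simp) (b := cfg (.inl .writeModCost) false (regs (x :: m) a b d e) o
      (query ι (List.replicate 2 (some true) ++ s))) ?_
    have h := ih (x :: m) (List.replicate 2 (some true) ++ s)
    rwa [← List.append_assoc (List.replicate _ _), ← List.replicate_add, ← mul_add_one,
      List.append_cons, ← List.reverse_cons] at h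

theorem run_skipFst (l : List Bool) (s : List (Option Bool)) :
    RunsIn stepM (l.length + 1)
      (cfg (.inl .skipFst) false (regs m a b d e) o
        (answer ο (l.map some ++ none :: s)))
      (cfg (.inl .readSnd) false (regs m a b d e) o (answer ο s)) := by
  induction l with
  | nil => exact RunsIn.step (by simp)
  | cons x l ih => exact RunsIn.head (by simp) ih

theorem run_skipSnd (l : List Bool) (s : List (Option Bool)) :
    RunsIn stepM (l.length + 1)
      (cfg (.inl .skipSnd) false (regs m a b d e) o
        (answer ο (l.map some ++ none :: s)))
      (cfg (.inl .turnPrime) false (regs m a b d e) (none :: o) (answer ο s)) := by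
  induction l with
  | nil => exact RunsIn.step (by simp)
  | cons x l ih => exact RunsIn.head (by simp) ih

theorem run_readRest (l : List Bool) (s : List (Option Bool)) :
    RunsIn stepM (l.length + 1)
      (cfg (.inl .readRest) false (regs m a b d e) o
        (answer ο (l.map some ++ none :: s)))
      (cfg (.inl .loadSnd) false (regs m (l.reverse ++ a) b d e) o
        (answer ο s)) := by
  induction l generalizing a with
  | nil => exact RunsIn.step (by simp)
  | cons x l ih =>
    exact RunsIn.head (by simp; rfl) (by simpa using ih (x :: a))

theorem run_loadSnd :
    RunsIn stepM (a.length + 1) (cfg (.inl .loadSnd) false (regs m a b d e) o S)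
      (cfg (.inl (.sub .factor)) false (regs m [] b (a.reverse ++ d) e) o S) := by
  induction a generalizing d with
  | nil => exact RunsIn.step (by simp)
  | cons x a ih => exact RunsIn.head (by simp; rfl) (by simpa using ih (x :: d))

theorem run_turnPrime :
    RunsIn stepM (m.length + 1) (cfg (.inl .turnPrime) false (regs m a b d e) o S)
      (cfg (.inl .writePrime) false (regs [] (m.reverse ++ a) b d e) o S) := by
  induction m generalizing a with
  | nil => exact RunsIn.step (by simp)
  | cons x m ih => exact RunsIn.head (by simp; rfl) (by simpa using ih (x :: a))

theorem run_writePrime :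
    RunsIn stepM (a.length + 1) (cfg (.inl .writePrime) false (regs m a b d e) o S)
      ⟨none, (⟨none, none, false⟩, A.initialState),
        stks (regs m [] b d e) (a.reverse.map some ++ o) S⟩ := by
  induction a generalizing o with
  | nil => exact RunsIn.step (by simp)
  | cons x a ih => exact RunsIn.head (by simp; rfl) (by simpa using ih (some x :: o))

theorem run_writeFactor :
    RunsIn stepM (b.length + 1) (cfg (.inl .writeFactor) false (regs m a b d e) o S)
      (cfg (.inl .restore) false (regs m a [] (b.reverse ++ d) e)
        (b.reverse.map some ++ o) S) := by
  induction b generalizing o d with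
  | nil => exact RunsIn.step (by simp)
  | cons x b ih => exact RunsIn.head (by simp; rfl) (by simpa using ih (x :: d) (some x :: o))

theorem run_restore :
    RunsIn stepM (a.length + 1) (cfg (.inl .restore) false (regs m a b d e) o S)
      (cfg (.inl .divide) false (regs (a.reverse ++ m) [] b d e) o S) := by
  induction a generalizing m with
  | nil => exact RunsIn.step (by simp)
  | cons x a ih => exact RunsIn.head (by simp; rfl) (by simpa using ih (x :: m))

/-- The difference is brought back, and its lowest bit is dropped. -/
theorem run_restoreRem :
    RunsIn stepM (b.length + 1) (cfg (.inl .restoreRem) false (regs m a b d e) o S)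
      (cfg (.inl .restoreDiv) false (regs (b.reverse ++ m).tail a [] d e) o S) := by
  induction b generalizing m with
  | nil => exact RunsIn.step (by simp)
  | cons x b ih => exact RunsIn.head (by simp; rfl) (by simpa using ih (x :: m))

theorem run_restoreDiv :
    RunsIn stepM (a.length + 1) (cfg (.inl .restoreDiv) false (regs m a b d e) o S)
      (cfg (.inl .divide) false (regs m [] b (a.reverse ++ d) e) o S) := by
  induction a generalizing d with
  | nil => exact RunsIn.step (by simp)
  | cons x a ih => exact RunsIn.head (by simp; rfl) (by simpa using ih (x :: d))

theorem run_clearDiv :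
    RunsIn stepM (d.length + 1) (cfg (.inl .clearDiv) false (regs m a b d e) o S)
      (cfg (.inl .stripQuotient) false (regs m a b [] e) o S) := by
  induction d with
  | nil => exact RunsIn.step (by simp)
  | cons x d ih => exact RunsIn.head (by simp) ih

theorem run_loadQuotient :
    RunsIn stepM (e.length + 1) (cfg (.inl .loadQuotient) false (regs m a b d e) o S)
      (cfg (.inl .start) false (regs (e.reverse ++ m) a b d []) o S) := by
  induction e generalizing m with
  | nil => exact RunsIn.step (by simp)
  | cons x e ih => exact RunsIn.head (by simp; rfl) (by simpa using ih (x :: m))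

/-- Which operand of a subtraction is preserved. -/
def kept (u : Use) (m d : List Bool) : List Bool :=
  match u with
  | .quotient => d
  | _ => m

/-- The loop of a subtraction, up to the point where both operands have been read. -/
theorem run_sub (u : Use) (c : Bool) : ∃ c',
    RunsIn stepM (max m.length d.length) (cfg (.inl (.sub u)) c (regs m a b d e) o S)
      (cfg (.inl (.sub u)) c' (regs [] ((kept u m d).reverse ++ a)
        ((subBits m d c).reverse ++ b) [] e) o S) := by
  fun_induction subBits m d c generalizing a b with
  | case1 c => exact ⟨c, by cases u <;> exact RunsIn.refl _⟩
  | case2 x l c ih =>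
    cases u
    case quotient =>
      obtain ⟨c', h⟩ := ih a ((x ^^ c) :: b)
      exact ⟨c', by simpa [kept] using RunsIn.head (by simp) h⟩
    all_goals
      obtain ⟨c', h⟩ := ih (x :: a) ((x ^^ c) :: b)
      exact ⟨c', by simpa [kept] using RunsIn.head (by simp) h⟩
  | case3 x l c ih =>
    cases u
    case quotient =>
      obtain ⟨c', h⟩ := ih (x :: a) ((x ^^ c) :: b)
      exact ⟨c', by simpa [kept] using RunsIn.head (by simp; tauto) h⟩
    all_goals
      obtain ⟨c', h⟩ := ih a ((x ^^ c) :: b)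
      exact ⟨c', by simpa [kept] using RunsIn.head (by simp; tauto) h⟩
  | case4 x l y l' c ih =>
    cases u
    case quotient =>
      obtain ⟨c', h⟩ := ih (y :: a) ((x ^^ y ^^ c) :: b)
      exact ⟨c', by simpa [kept] using RunsIn.head (by simp) h⟩
    all_goals
      obtain ⟨c', h⟩ := ih (x :: a) ((x ^^ y ^^ c) :: b)
      exact ⟨c', by simpa [kept] using RunsIn.head (by simp) h⟩

end Loops

/-! ### The oracle call -/

/-- Between two calls all stacks of the oracle are empty. -/
theorem query_nil : query ι [] = answer ο [] := by
  funext k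
  simp only [query, answer, only, List.map_nil]
  rw [Function.update_eq_self_iff.2 rfl, Function.update_eq_self_iff.2 rfl]

/-- The configuration of the factoring machine that simulates a configuration of the oracle. -/
def emb (R : Reg → List Bool) (o : List (Option Bool)) (C : TM2.Cfg A.Γ A.Λ A.σ) :
    TM2.Cfg (Alph A) (Lb A) (St A) :=
  ⟨some (C.l.elim (.inl .skipFst) .inr), (⟨none, none, false⟩, C.var), stks R o C.stk⟩

theorem stepAux_sim (R : Reg → List Bool) (o : List (Option Bool)) (q : TM2.Stmt A.Γ A.Λ A.σ)
    (w : A.σ) (S : ∀ k, List (A.Γ k)) :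
    TM2.stepAux (sim q) (⟨none, none, false⟩, w) (stks R o S) =
      emb R o (TM2.stepAux q w S) := by
  induction q generalizing w S with
  | push k f q ih =>
    exact (congrArg (TM2.stepAux (sim q) _) (update_stks_oracle R o S k _)).trans (ih w _)
  | peek k f q ih => exact ih _ _
  | pop k f q ih =>
    exact (congrArg (TM2.stepAux (sim q) _) (update_stks_oracle R o S k _)).trans (ih _ _)
  | load f q ih => exact ih _ _
  | branch f q q' ih ih' =>
    simp only [sim, TM2.stepAux]
    cases f w
    · exact ih' _ _
    · exact ih _ _
  | goto f => rfl
  | halt => rfl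

theorem initList_eq (s : List (A.Γ A.k₀)) :
    initList A s = ⟨some A.main, A.initialState, only A.k₀ s⟩ := by
  unfold initList
  congr 1
  funext k
  by_cases h : k = A.k₀
  · subst h; simp [only]
  · simp [only, h]

theorem haltList_eq (s : List (A.Γ A.k₁)) :
    haltList A s = ⟨none, A.initialState, only A.k₁ s⟩ := by
  unfold haltList
  congr 1
  funext k
  by_cases h : k = A.k₁
  · subst h; simp [only]
  · simp [only, h]

/-- A call of the oracle. -/
theorem run_oracle {s s' : List (Option Bool)} {t : ℕ} (R : Reg → List Bool)
    (o : List (Option Bool))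
    (h : TM2OutputsInTime A (s.map ι.symm) (some (s'.map ο.symm)) t) :
    RunsIn stepM t (cfg (.inr A.main) false R o (query ι s))
      (cfg (.inl .skipFst) false R o (answer ο s')) := by
  have h' := (EvalsToInTime.runsIn h).map (g := stepM) (φ := emb R o) (by
    rintro ⟨_ | l, w, S⟩ C hC
    · cases hC
    · obtain rfl := Option.some.inj hC
      exact congrArg some (stepAux_sim R o _ w S))
  rwa [initList_eq, haltList_eq] at h'

/-! ### Writing the instance -/

theorem encodeList_cons (n : ℕ) (l : List ℕ) :
    FCMJ.encodeList (n :: l) = n.bits.map some ++ none :: FCMJ.encodeList l := by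
  simp [FCMJ.encodeList]

/-- The instance that the machine asks the oracle to solve in order to split `M`. -/
abbrev inst (M : ℕ) (hM : 3 ≤ M) : FCMJ :=
  .pair (2 ^ (2 * M.bits.length) - 1) (2 ^ (3 * M.bits.length) - 1) 1 M (M - 2) (by omega)
    (by omega)

theorem encode_inst (M : ℕ) (hM : 3 ≤ M) : FCMJ.encode (inst M hM) =
    headerWord ++ (List.replicate (2 * M.bits.length) (some true) ++
      (none :: (List.replicate (3 * M.bits.length) (some true) ++
        (none :: some true :: none :: (M.bits.map some ++
          (none :: ((M - 2).bits.map some ++ [none]))))))) := by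
  have h2 : Nat.bits 2 = [false, true] := by decide
  simp [FCMJ.encode, FCMJ.toList, headerWord, bits_two_pow_sub_one, h2,
    FCMJ.encodeList]

theorem length_encode_inst_le (M : ℕ) (hM : 3 ≤ M) :
    (FCMJ.encode (inst M hM)).length ≤ 7 * M.bits.length + 15 := by
  have := length_bits_mono (Nat.sub_le M 2)
  rw [encode_inst]
  simp only [headerWord, List.length_append, List.length_cons, List.length_nil,
    List.length_replicate, List.length_map]
  omega

theorem bits_of_odd {n : ℕ} (h : n % 2 = 1) : n.bits = true :: (n / 2).bits := by
  have := bits_cons true (n / 2) (Or.inl rfl)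
  rwa [show true.toNat + 2 * (n / 2) = n by rw [Bool.toNat_true]; omega] at this

theorem bits_of_even {n : ℕ} (h : n % 2 = 0) (h0 : n ≠ 0) :
    n.bits = false :: (n / 2).bits := by
  have := bits_cons false (n / 2) (Or.inr (by omega))
  rwa [show false.toNat + 2 * (n / 2) = n by rw [Bool.toNat_false]; omega] at this

theorem stripZeros_subBits {a b : ℕ} (h : b ≤ a) (l : List Bool) (hl : bitsVal l = b) :
    (stripZeros (subBits a.bits l false).reverse).reverse = (a - b).bits := by
  have := bitsVal_subBits a.bits l false (by rw [bitsVal_bits, hl]; simpa using h)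
  rw [bitsVal_bits, hl, Bool.toNat_false] at this
  rw [reverse_stripZeros, List.reverse_reverse]
  congr 1
  omega

/-- From the start of a round, with an odd number `M ≥ 3`, to the call of the oracle. -/
theorem run_query (M : ℕ) (hM : 3 ≤ M) (hodd : M % 2 = 1) (o : List (Option Bool)) :
    RunsIn stepM (8 * M.bits.length + 20)
      (cfg (.inl .start) false (regs M.bits [] [] [] []) o (query ι []))
      (cfg (.inr A.main) false (regs M.bits [] [] [] []) o
        (query ι (FCMJ.encode (inst M hM)))) := by
  have h1 : RunsIn stepM 1 (cfg (.inl .start) false (regs M.bits [] [] [] []) o (query ι []))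
      (cfg (.inl (.sub .limit)) false (regs M.bits [] [] [false, true] []) o (query ι [])) := by
    have : (M / 2).bits ≠ [] := by
      intro h
      have := bitsVal_bits (M / 2)
      rw [h, bitsVal] at this
      omega
    obtain ⟨x, l, hl⟩ := List.exists_cons_of_ne_nil this
    rw [bits_of_odd hodd, hl]
    exact RunsIn.step (by simp)
  obtain ⟨c, h2⟩ := run_sub ι ο M.bits [] [] [false, true] [] o (query ι []) .limit false
  have h3 : RunsIn stepM 1
      (cfg (.inl (.sub .limit)) c (regs [] M.bits.reverse
        (subBits M.bits [false, true] false).reverse [] []) o (query ι []))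
      (cfg (.inl .stripLimit) false (regs [] M.bits.reverse
        (subBits M.bits [false, true] false).reverse [] []) o (query ι [none])) :=
    RunsIn.step (by simp)
  have h4 := run_stripLimit ι ο [] M.bits.reverse (subBits M.bits [false, true] false).reverse [] []
    o (query ι [none])
  have h5 := run_writeLimit ι ο [] M.bits.reverse
    (stripZeros (subBits M.bits [false, true] false).reverse) [] [] o [none]
  rw [stripZeros_subBits (by omega : 2 ≤ M) _ rfl] at h5
  have h6 := run_writeNumber ι ο [] M.bits.reverse [] [] [] o
    (none :: ((M - 2).bits.map some ++ [none]))
  have h7 := run_writeCost ι ο M.bits [] [] [] [] o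
    (none :: some true :: none :: (M.bits.map some ++ (none :: ((M - 2).bits.map some ++ [none]))))
  have h8 := run_writeModCost ι ο [] M.bits.reverse [] [] [] o
    (none :: (List.replicate (3 * M.bits.length) (some true) ++
        (none :: some true :: none :: (M.bits.map some ++
          (none :: ((M - 2).bits.map some ++ [none]))))))
  simp only [kept, List.reverse_reverse, List.append_nil, List.length_reverse] at h2 h4 h5 h6 h7 h8
  rw [← encode_inst M hM] at h8
  refine ((((((((h1.trans h2).trans h3).trans h4).trans h5).trans h6).trans h7).trans h8)).mono ?_
  have e1 := length_subBits M.bits [false, true] false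
  have e2 := length_stripZeros_le (subBits M.bits [false, true] false).reverse
  simp only [List.length_cons, List.length_nil, List.length_reverse] at e1 e2 ⊢
  omega

/-! ### Division by an odd number -/

/-- Exact division by an odd number `g`, lowest bit first. The word `m` may end in zeros, and so may
the quotient `Q`. -/
theorem run_divide (g : ℕ) (hg : g % 2 = 1) (o : List (Option Bool)) (S : ∀ k, List (A.Γ k))
    (L n : ℕ) (m e : List Bool) (k : ℕ) (hn : m.length = n) (hL : n ≤ L) (hm : bitsVal m = g * k) :
    ∃ Q : List Bool, Q.length = n ∧ bitsVal Q = k ∧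
      RunsIn stepM (n * (3 * L + 5)) (cfg (.inl .divide) false (regs m [] [] g.bits e) o S)
        (cfg (.inl .divide) false (regs [] [] [] g.bits (Q.reverse ++ e)) o S) := by
  induction n generalizing m e k with
  | zero =>
    obtain rfl := List.length_eq_zero_iff.1 hn
    have : k = 0 := by
      rcases Nat.mul_eq_zero.1 hm.symm with h | h
      · omega
      · exact h
    exact ⟨[], rfl, this.symm, by simpa using RunsIn.refl _⟩
  | succ n ih =>
    rcases m with _ | ⟨x, m⟩
    · simp at hn
    have hn' : m.length = n := by simpa using hn
    have hmod : (g * k) % 2 = k % 2 := by rw [Nat.mul_mod, hg, one_mul, Nat.mod_mod]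
    cases x
    · have hk : k = 2 * (k / 2) := by
        simp only [bitsVal, Bool.toNat_false] at hm
        omega
      have hm' : bitsVal m = g * (k / 2) := by
        rw [hk, bitsVal, Bool.toNat_false, mul_left_comm] at hm
        omega
      obtain ⟨Q, hQ, hQk, h⟩ := ih m (false :: e) (k / 2) hn' (by omega) hm'
      refine ⟨false :: Q, by simp [hQ], by rw [bitsVal, hQk, Bool.toNat_false]; omega, ?_⟩
      rw [List.reverse_cons, List.append_assoc, List.singleton_append]
      exact (RunsIn.head (by simp) h).mono (by rw [add_mul]; omega)
    · have hk : k = 2 * (k / 2) + 1 := by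
        simp only [bitsVal, Bool.toNat_true] at hm
        omega
      have hle : g ≤ bitsVal (true :: m) := hm ▸ Nat.le_mul_of_pos_right g (by omega)
      -- The divisor is not longer than the remainder, so the subtraction keeps the length.
      have hlen : g.bits.length ≤ n + 1 :=
        (length_bits_mono hle).trans ((length_bits_bitsVal_le _).trans hn.le)
      have hsub := bitsVal_subBits (true :: m) g.bits false (by rwa [bitsVal_bits])
      have hslen := length_subBits (true :: m) g.bits false
      have hmul : g * k = 2 * (g * (k / 2)) + g := by
        conv_lhs => rw [hk]
        ring
      obtain ⟨y, m', hs⟩ : ∃ y m', subBits (true :: m) g.bits false = y :: m' := by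
        rw [bits_of_odd hg]
        rw [subBits]
        exact ⟨_, _, rfl⟩
      rw [bitsVal_bits, hm, hmul, Bool.toNat_false, hs, bitsVal] at hsub
      have hlen' : m'.length = n := by
        rw [hs, List.length_cons, List.length_cons] at hslen
        omega
      have hy := Bool.toNat_le y
      obtain ⟨Q, hQ, hQk, h⟩ := ih m' (true :: e) (k / 2) hlen' (by omega) (by omega)
      refine ⟨true :: Q, by simp [hQ], by rw [bitsVal, hQk, Bool.toNat_true]; omega, ?_⟩
      rw [List.reverse_cons, List.append_assoc, List.singleton_append]
      have h1 : RunsIn stepM 1 (cfg (.inl .divide) false (regs (true :: m) [] [] g.bits e) o S)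
          (cfg (.inl (.sub .quotient)) false (regs (true :: m) [] [] g.bits (true :: e)) o S) :=
        RunsIn.step (by simp)
      obtain ⟨c, h2⟩ := run_sub ι ο (true :: m) [] [] g.bits (true :: e) o S .quotient false
      have h3 : RunsIn stepM 1
          (cfg (.inl (.sub .quotient)) c (regs [] g.bits.reverse (y :: m').reverse [] (true :: e)) o
            S)
          (cfg (.inl .restoreRem) false (regs [] g.bits.reverse (y :: m').reverse [] (true :: e)) o
            S) := RunsIn.step (by simp)
      have h4 := run_restoreRem ι ο [] g.bits.reverse (y :: m').reverse [] (true :: e) o S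
      have h5 := run_restoreDiv ι ο m' g.bits.reverse [] [] (true :: e) o S
      rw [hs] at h2
      simp only [kept, List.append_nil] at h2 h4 h5
      rw [List.reverse_reverse, List.tail_cons] at h4
      rw [List.reverse_reverse] at h5
      refine (((((h1.trans h2).trans h3).trans h4).trans h5).trans h).mono ?_
      simp only [List.length_cons, List.length_reverse]
      rw [add_mul]
      omega

/-! ### Reading the answer -/

/-- An odd answer `q₂` makes the machine put out `M` and halt. -/
theorem run_prime (M q₁ q₂ : ℕ) (hq : q₂ % 2 = 1) (hle₁ : q₁ ≤ M) (hle₂ : q₂ ≤ M) (acc : List ℕ) :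
    RunsIn stepM (4 * M.bits.length + 5)
      (cfg (.inl .skipFst) false (regs M.bits [] [] [] []) (FCMJ.encodeList acc)
        (answer ο (FCMJ.encodeList [q₁, q₂])))
      ⟨none, (⟨none, none, false⟩, A.initialState),
        stks (regs [] [] [] [] []) (FCMJ.encodeList (M :: acc)) (query ι [])⟩ := by
  have e1 := length_bits_mono hle₁
  have e2 := length_bits_mono hle₂
  rw [encodeList_cons, encodeList_cons, encodeList_cons, query_nil ι ο]
  have h1 := run_skipFst ι ο M.bits [] [] [] [] (FCMJ.encodeList acc) q₁.bits
    (q₂.bits.map some ++ none :: FCMJ.encodeList [])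
  rw [bits_of_odd hq] at h1 e2 ⊢
  have h2 : RunsIn stepM 1
      (cfg (.inl .readSnd) false (regs M.bits [] [] [] []) (FCMJ.encodeList acc)
        (answer ο ((true :: (q₂ / 2).bits).map some ++ none :: FCMJ.encodeList [])))
      (cfg (.inl .skipSnd) false (regs M.bits [] [] [] []) (FCMJ.encodeList acc)
        (answer ο ((q₂ / 2).bits.map some ++ none :: FCMJ.encodeList []))) :=
    RunsIn.step (by simp)
  have h3 := run_skipSnd ι ο M.bits [] [] [] [] (FCMJ.encodeList acc) (q₂ / 2).bits
    (FCMJ.encodeList [])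
  have h4 := run_turnPrime ι ο M.bits [] [] [] [] (none :: FCMJ.encodeList acc)
    (answer ο (FCMJ.encodeList []))
  have h5 := run_writePrime ι ο [] M.bits.reverse [] [] [] (none :: FCMJ.encodeList acc)
    (answer ο (FCMJ.encodeList []))
  rw [List.append_nil] at h4
  rw [List.reverse_reverse] at h5
  refine ((((h1.trans h2).trans h3).trans h4).trans h5).mono ?_
  simp only [List.length_cons, List.length_reverse] at e2 ⊢
  omega

/-- An even answer `M - g` makes the machine put out `g` and start a new round with `M / g`. -/
theorem run_split (M g q₁ : ℕ) (hM : M % 2 = 1) (hg : g % 2 = 1) (hlt : g < M) (hdvd : g ∣ M)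
    (hle₁ : q₁ ≤ M) (acc : List ℕ) :
    RunsIn stepM (3 * M.bits.length ^ 2 + 16 * M.bits.length + 15)
      (cfg (.inl .skipFst) false (regs M.bits [] [] [] []) (FCMJ.encodeList acc)
        (answer ο (FCMJ.encodeList [q₁, M - g])))
      (cfg (.inl .start) false (regs (M / g).bits [] [] [] []) (FCMJ.encodeList (g :: acc))
        (query ι [])) := by
  have e1 := length_bits_mono hle₁
  have e2 := length_bits_mono (Nat.sub_le M g)
  have e3 := length_bits_mono hlt.le
  have hev := bits_of_even (n := M - g) (by omega) (by omega)
  set r := ((M - g) / 2).bits with hr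
  rw [encodeList_cons, encodeList_cons, encodeList_cons, query_nil ι ο]
  have h1 := run_skipFst ι ο M.bits [] [] [] [] (FCMJ.encodeList acc) q₁.bits
    ((M - g).bits.map some ++ none :: FCMJ.encodeList [])
  have h2 : RunsIn stepM 1
      (cfg (.inl .readSnd) false (regs M.bits [] [] [] []) (FCMJ.encodeList acc)
        (answer ο ((M - g).bits.map some ++ none :: FCMJ.encodeList [])))
      (cfg (.inl .readRest) false (regs M.bits [false] [] [] []) (FCMJ.encodeList acc)
        (answer ο (r.map some ++ none :: FCMJ.encodeList []))) := by
    rw [hev]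
    exact RunsIn.step (by simp)
  have h3 := run_readRest ι ο M.bits [false] [] [] [] (FCMJ.encodeList acc) r (FCMJ.encodeList [])
  rw [← List.reverse_cons, ← hev] at h3
  have h4 := run_loadSnd ι ο M.bits (M - g).bits.reverse [] [] [] (FCMJ.encodeList acc)
    (answer ο (FCMJ.encodeList []))
  obtain ⟨c, h5⟩ := run_sub ι ο M.bits [] [] (M - g).bits [] (FCMJ.encodeList acc)
    (answer ο (FCMJ.encodeList [])) .factor false
  set s := subBits M.bits (M - g).bits false with hs
  have h6 : RunsIn stepM 1
      (cfg (.inl (.sub .factor)) c (regs [] M.bits.reverse s.reverse [] []) (FCMJ.encodeList acc)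
        (answer ο (FCMJ.encodeList [])))
      (cfg (.inl .stripFactor) false (regs [] M.bits.reverse s.reverse [] [])
        (none :: FCMJ.encodeList acc) (answer ο (FCMJ.encodeList []))) := RunsIn.step (by simp)
  have h7 := run_stripFactor ι ο [] M.bits.reverse s.reverse [] [] (none :: FCMJ.encodeList acc)
    (answer ο (FCMJ.encodeList []))
  have h8 := run_writeFactor ι ο [] M.bits.reverse (stripZeros s.reverse) [] []
    (none :: FCMJ.encodeList acc) (answer ο (FCMJ.encodeList []))
  rw [hs, stripZeros_subBits (Nat.sub_le M g) _ (bitsVal_bits _), ← hs,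
    Nat.sub_sub_self hlt.le] at h8
  set o := g.bits.map some ++ none :: FCMJ.encodeList acc
  have h9 := run_restore ι ο [] M.bits.reverse [] g.bits [] o (answer ο (FCMJ.encodeList []))
  obtain ⟨Q, hQ, hQk, h10⟩ := run_divide ι ο g hg o (answer ο (FCMJ.encodeList [])) M.bits.length
    M.bits.length M.bits [] (M / g) rfl le_rfl (by rw [bitsVal_bits, Nat.mul_div_cancel' hdvd])
  have h11 : RunsIn stepM 1
      (cfg (.inl .divide) false (regs [] [] [] g.bits Q.reverse) o (answer ο (FCMJ.encodeList [])))
      (cfg (.inl .clearDiv) false (regs [] [] [] g.bits Q.reverse) o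
        (answer ο (FCMJ.encodeList []))) := RunsIn.step (by simp)
  have h12 := run_clearDiv ι ο [] [] [] g.bits Q.reverse o (answer ο (FCMJ.encodeList []))
  have h13 := run_stripQuotient ι ο [] [] [] [] Q.reverse o (answer ο (FCMJ.encodeList []))
  have h14 := run_loadQuotient ι ο [] [] [] [] (stripZeros Q.reverse) o
    (answer ο (FCMJ.encodeList []))
  rw [reverse_stripZeros, List.reverse_reverse, hQk] at h14
  simp only [kept, List.append_nil, List.reverse_reverse] at h4 h5 h8 h9 h10 h14
  refine (((((((((((((h1.trans h2).trans h3).trans h4).trans h5).trans h6).trans h7).trans h8).trans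
    h9).trans h10).trans h11).trans h12).trans h13).trans h14).mono ?_
  have e4 := length_subBits M.bits (M - g).bits false
  have e5 := length_stripZeros_le s.reverse
  have e6 := length_stripZeros_le Q.reverse
  have e7 : r.length + 1 = (M - g).bits.length := by rw [hev, List.length_cons]
  rw [← hs] at e4
  simp only [List.length_reverse] at e5 e6 ⊢
  have e8 : M.bits.length * (3 * M.bits.length + 5) =
      3 * M.bits.length ^ 2 + 5 * M.bits.length := by ring
  omega

/-! ### The factorization -/

/-- A bound for the number of steps of one round, on numbers of at most `L` bits. -/
def roundTime (p : Polynomial ℕ) (L : ℕ) : ℕ :=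
  p.eval (7 * L + 15) + (3 * L ^ 2 + 24 * L + 40)

theorem polynomial_eval_mono (p : Polynomial ℕ) : Monotone fun n => p.eval n := by
  intro a b h
  simp only [Polynomial.eval_eq_sum, Polynomial.sum]
  exact Finset.sum_le_sum fun i _ => Nat.mul_le_mul_left _ (Nat.pow_le_pow_left h i)

theorem snd_eq_of_isOptimal_inst {M : ℕ} {hM : 3 ≤ M} {q : Fin 2 → ℕ}
    (hq : (inst M hM).IsOptimal q) :
    q 0 = M ∧ q 1 = M - if M.Prime then 2 else M.minFac := by
  have hlt : M < 2 ^ M.bits.length := by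
    have := bitsVal_lt M.bits
    rwa [bitsVal_bits] at this
  have hle : M ^ 2 + 1 ≤ 2 ^ (2 * M.bits.length) := by
    rw [mul_comm, pow_mul]
    exact Nat.pow_lt_pow_left hlt two_ne_zero
  refine FCMJ.IsOptimal.snd_eq hq (by omega) (Nat.le_sub_one_of_lt ?_)
  rw [show 3 * M.bits.length = 2 * M.bits.length + M.bits.length by ring, pow_add]
  exact Nat.mul_lt_mul'' (by omega) (by omega)

/-- With a polynomial-time oracle for the problem, the machine factors `M` and puts the primes in
front of what has been put out already. -/
theorem exists_run {alg : FCMJ → List ℕ} {p : Polynomial ℕ}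
    (hopt : ∀ I : FCMJ, ∃ q : Fin I.numComp → ℕ, I.IsOptimal q ∧ alg I = List.ofFn q)
    (hout : ∀ I : FCMJ, TM2OutputsInTime A ((FCMJ.encode I).map ι.symm)
      (some ((FCMJ.encodeList (alg I)).map ο.symm)) (p.eval (FCMJ.encode I).length))
    (L M : ℕ) (hL : M.bits.length ≤ L) (acc : List ℕ) :
    ∃ l : List ℕ, (M ≠ 0 → (∀ r ∈ l, r.Prime) ∧ l.prod = M) ∧
      RunsIn stepM ((M.bits.length + 1) * roundTime p L)
        (cfg (.inl .start) false (regs M.bits [] [] [] []) (FCMJ.encodeList acc) (query ι []))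
        ⟨none, (⟨none, none, false⟩, A.initialState),
          stks (regs [] [] [] [] []) (FCMJ.encodeList (l ++ acc)) (query ι [])⟩ := by
  induction M using Nat.strong_induction_on generalizing acc with
  | _ M ih =>
    have hone : 1 ≤ roundTime p L := by unfold roundTime; omega
    have hround : roundTime p L ≤ (M.bits.length + 1) * roundTime p L :=
      Nat.le_mul_of_pos_left _ (Nat.succ_pos _)
    rcases Nat.eq_zero_or_pos M with rfl | hpos
    · exact ⟨[], by simp, (RunsIn.step (by simp)).mono (hone.trans hround)⟩
    rcases Nat.mod_two_eq_zero_or_one M with heven | hodd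
    · have hb := bits_of_even heven hpos.ne'
      have hlen : M.bits.length = (M / 2).bits.length + 1 := by rw [hb, List.length_cons]
      obtain ⟨l, hl, h⟩ := ih (M / 2) (by omega) (by omega) (2 :: acc)
      obtain ⟨hp, hprod⟩ := hl (by omega)
      refine ⟨l ++ [2], fun _ => ⟨?_, ?_⟩, ?_⟩
      · simpa [or_imp, forall_and, Nat.prime_two] using hp
      · rw [List.prod_append, hprod, List.prod_singleton]
        omega
      · rw [List.append_assoc, List.singleton_append]
        rw [encodeList_cons, show Nat.bits 2 = [false, true] by decide] at h
        refine (RunsIn.head (by rw [hb]; simp) h).mono ?_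
        rw [hlen]
        linarith
    by_cases h1 : M = 1
    · subst h1
      exact ⟨[], by simp, (RunsIn.step (by simp)).mono (hone.trans hround)⟩
    have hM : 3 ≤ M := by omega
    obtain ⟨q, hq, halg⟩ := hopt (inst M hM)
    obtain ⟨hq0, hq1⟩ := snd_eq_of_isOptimal_inst hq
    have halg' : alg (inst M hM) = [q 0, q 1] := by
      rw [halg]
      exact (List.ofFn_succ ..).trans (by simp)
    have hquery := run_query ι ο M hM hodd (FCMJ.encodeList acc)
    have horacle := run_oracle ι ο (regs M.bits [] [] [] []) (FCMJ.encodeList acc)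
      (hout (inst M hM))
    rw [halg', hq0, hq1] at horacle
    have htime : p.eval (FCMJ.encode (inst M hM)).length ≤ p.eval (7 * L + 15) :=
      polynomial_eval_mono p ((length_encode_inst_le M hM).trans (by omega))
    have hsq : M.bits.length ^ 2 ≤ L ^ 2 := Nat.pow_le_pow_left hL 2
    by_cases hprime : M.Prime
    · rw [if_pos hprime] at horacle
      refine ⟨[M], fun _ => by simpa using hprime, ?_⟩
      refine ((hquery.trans horacle).trans
        (run_prime ι ο M M (M - 2) (by omega) le_rfl (by omega) acc)).mono (le_trans ?_ hround)
      unfold roundTime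
      omega
    · rw [if_neg hprime] at horacle
      have hdvd := Nat.minFac_dvd M
      have hpf := Nat.minFac_prime h1
      have hfodd : M.minFac % 2 = 1 := by
        rcases Nat.mod_two_eq_zero_or_one M.minFac with h | h
        · have := (Nat.dvd_of_mod_eq_zero h).trans hdvd
          omega
        · exact h
      have hflt : M.minFac < M :=
        lt_of_le_of_ne (Nat.minFac_le hpos) fun h => hprime (h ▸ hpf)
      have hsplit := run_split ι ο M M.minFac M hodd hfodd hflt hdvd le_rfl acc
      have hdiv : M / M.minFac * 2 ≤ M :=
        (Nat.mul_le_mul_left _ hpf.two_le).trans (Nat.div_mul_le_self _ _)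
      have hlen : (M / M.minFac).bits.length + 1 ≤ M.bits.length := by
        have := length_bits_mono (show M / M.minFac ≤ M / 2 by omega)
        rw [bits_of_odd hodd, List.length_cons]
        omega
      obtain ⟨l, hl, h⟩ := ih (M / M.minFac) (by omega) (by omega) (M.minFac :: acc)
      obtain ⟨hp, hprod⟩ := hl (Nat.div_pos hflt.le hpf.pos).ne'
      refine ⟨l ++ [M.minFac], fun _ => ⟨?_, ?_⟩, ?_⟩
      · simpa [or_imp, forall_and, hpf] using hp
      · rw [List.prod_append, hprod, List.prod_singleton, Nat.div_mul_cancel hdvd]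
      · rw [List.append_assoc, List.singleton_append]
        refine (((hquery.trans horacle).trans hsplit).trans h).mono ?_
        have : roundTime p L + ((M / M.minFac).bits.length + 1) * roundTime p L ≤
            (M.bits.length + 1) * roundTime p L := by
          rw [add_comm, ← Nat.succ_mul]
          exact Nat.mul_le_mul_right _ (Nat.succ_le_succ hlen)
        refine le_trans (Nat.add_le_add_right ?_ _) this
        unfold roundTime
        omega

/-- The factoring machine as a bundled machine with finitely many labels, stacks and states. -/
def machine : FinTM2 :=
  haveI := A.kFin
  haveI := A.ΛFin
  haveI := A.σFin
  { K := Stk A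
    k₀ := .inl .m
    k₁ := .inr none
    Γ := Alph A
    Λ := Lb A
    main := .inl .start
    σ := St A
    initialState := (⟨none, none, false⟩, A.initialState)
    Γk₀Fin := inferInstanceAs (Fintype Bool)
    m := prog ι ο }

theorem initList_machine (l : List Bool) : initList (machine ι ο) l =
    cfg (.inl .start) false (regs l [] [] [] []) [] (query ι []) := by
  refine (initList_eq (A := machine ι ο) l).trans (congrArg (TM2.Cfg.mk _ _) ?_)
  funext k
  rcases k with (_ | _ | _ | _ | _) | _ | k <;> try rfl
  change [] = only A.k₀ [] k
  rw [only, Function.update_eq_self_iff.2 rfl]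

theorem haltList_machine (o : List (Option Bool)) : haltList (machine ι ο) o =
    ⟨none, (⟨none, none, false⟩, A.initialState),
      stks (regs [] [] [] [] []) o (query ι [])⟩ := by
  refine (haltList_eq (A := machine ι ο) o).trans (congrArg (TM2.Cfg.mk _ _) ?_)
  funext k
  rcases k with (_ | _ | _ | _ | _) | _ | k <;> try rfl
  change [] = only A.k₀ [] k
  rw [only, Function.update_eq_self_iff.2 rfl]

end FactorMachine

open FactorMachine in
theorem FCMJ.PolyTimeSolvable.factorizationPolyTime (h : FCMJ.PolyTimeSolvable) :
    FCMJ.FactorizationPolyTime := by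
  obtain ⟨alg, hopt, ⟨⟨⟨A, inA, outA⟩, p, hout⟩⟩⟩ := h
  have hrun := fun n => exists_run inA outA hopt hout n.bits.length n le_rfl []
  choose F hF hFrun using hrun
  have houtputs : ∀ n l l' t, l = n.bits → l' = FCMJ.encodeList (F n) →
      t = (n.bits.length + 1) * roundTime p n.bits.length →
      Nonempty (TM2OutputsInTime (machine inA outA) l (some l') t) := by
    rintro n _ _ _ rfl rfl rfl
    have h := hFrun n
    rw [List.append_nil] at h
    refine RunsIn.nonempty_evalsToInTime (?_ : RunsIn _ _ (initList (machine inA outA) n.bits)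
      (haltList (machine inA outA) (FCMJ.encodeList (F n))))
    rw [initList_machine, haltList_machine]
    exact h
  -- The polynomial is `(X + 1) * roundTime p X`.
  refine ⟨F, hF, ⟨⟨⟨machine inA outA, Equiv.refl Bool, Equiv.refl (Option Bool)⟩,
    (.X + 1) * (p.comp (7 * .X + 15) + (3 * .X ^ 2 + 24 * .X + 40)), fun n =>
      Classical.choice (houtputs n _ _ _ (List.map_id _) (List.map_id _) ?_)⟩⟩⟩
  simp [roundTime]

theorem theorem1 :
    (FCMJ.PolyTimeSolvable → FCMJ.FactorizationPolyTime) ∧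
    ∀ (M : ℕ) (hM : 3 ≤ M), ¬ M.Prime →
      ∀ q : Fin 2 → ℕ, (FCMJ.ofNat M hM).IsOptimal q →
        q 0 = M ∧ Nat.gcd (q 1) M ∣ M ∧ 1 < Nat.gcd (q 1) M ∧ Nat.gcd (q 1) M < M :=
  ⟨fun h => h.factorizationPolyTime, FCMJ.gcd_bounds_of_isOptimal_ofNat⟩
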